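/- Setting. Let $G$ be a stochastic reachability game with active sensing and sensor attacks: a finite state set $S$, a finite set $A_1$ of control actions, a finite set $\Sigma$ of sensors, sets $\Gamma_1,\Gamma_2\subseteq 2^{\Sigma}$ of query actions of P1 and attack actions of P2, transition probabilities $\mathbf P(s,a,\cdot)$, observations $\mathsf{Obs}(s,\gamma_1,\gamma_2)\subseteq S$ of P1, and goal states $F\subseteq S$. A sensor $\sigma_0\in\Sigma$ is hidden from P2. Put $\Gamma_i^2=\{\gamma\in\Gamma_i\mid\sigma_0\notin\gamma\}$ and $\mathbf A_1=A_1\times\Gamma_1$, $\mathbf A_1^2=A_1\times\Gamma_1^2$. For $B\subseteq S$ let $\mathsf{Post}_G(B,a)=\{s'\mid\exists s\in B,\ \mathbf P(s,a,s')>0\}$. Fix a delay $\tau\in\mathbb N$ and $\epsilon\in(0,1)$. The sensor-revealing game $\mathcal H$ has P1 states $(s,B,\kappa)$, nature states $(s,B,a,\gamma_1,\kappa)$, P2 states $(s,B,\gamma_1,\kappa)$, where $s\in S$, $B\subseteq S$ (P1's belief), $\kappa\in\{-1,0,\dots,\tau\}$, and an absorbing final state $q_F$. At $(s,B,\kappa)$,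 P1 chooses $(a,\gamma_1)\in\mathbf A_1$ and the game moves to $(s,\mathsf{Post}_G(B,a),a,\gamma_1,\kappa')$, where $\kappa'=\kappa$ if $\kappa=\tau$ or if $\kappa=-1$ and $\sigma_0\notin\gamma_1$, and $\kappa'=\kappa+1$ otherwise. At $(s,B,a,\gamma_1,\kappa)$ the game moves to $q_F$ if $\mathsf{Post}_G(\{s\},a)\subseteq F$; it moves to $(s',B,\gamma_1,\kappa)$ with probability $\mathbf P(s,a,s')$ if $\mathsf{Post}_G(\{s\},a)\cap F=\emptyset$; otherwise it moves to $q_F$ with probability $\epsilon$ and to $(s',B,\gamma_1,\kappa)$ with probability $(1-\epsilon)\mathbf P(s,a,s')$. At $(s,B,\gamma_1,\kappa)$, P2 chooses $\gamma_2\in\Gamma_2$, with $\gamma_2\in\Gamma_2^2$ if $\kappa<\tau$, and the game moves to $(s,B\cap\mathsf{Obs}(s,\gamma_1,\gamma_2),\kappa)$. P1's objective is to reach $q_F$. P2's belief-augmented perceptual game $\mathcal G^2$ is the restriction of $\mathcal H$ to the states with $\kappa=-1$ (and $q_F$), to P1's actions in $\mathbf A_1^2$, and to P2's actions in $\Gamma_2^2$.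 Strategies are randomized functions of play prefixes; a strategy of P1 is belief-based if its choice at $(s,B,\kappa)$ depends on $(B,\kappa)$ only. In $\mathcal G^2$, $\mathsf{ASW}_1$ (resp. $\mathsf{PWin}_1$) is the set of states from which P1 has a belief-based strategy that reaches $q_F$ with probability one (resp. with positive probability) against every strategy of P2, and $\mathsf{ASW}_2$ is the set of states from which P2 has a strategy under which $q_F$ is reached with probability zero for every belief-based strategy of P1. For a P1 state $q\in\mathsf{PWin}_1(\mathcal G^2)\setminus\mathsf{ASW}_1(\mathcal G^2)$, an action of P1 is subjectively rationalizable if it lies in $$\mathsf{SR}_1(q,\mathcal G^2)=\{x\in\mathbf A_1^2\mid \mathsf{Post}_{\mathcal G^2}(q,x)\not\subseteq\mathsf{ASW}_2(\mathcal G^2)\},$$ where $\mathsf{Post}_{\mathcal G^2}(q,x)$ is the set of successors of $q$ under $x$ (for $q\in\mathsf{ASW}_1(\mathcal G^2)$ the condition is instead $\mathsf{Post}_{\mathcal G^2}(q,x)\subseteq\mathsf{ASW}_1(\mathcal G^2)$). Lemma. Let $q=(s,B,-1)$ be a state that is positive winning but not almost-sure winning for P1 in $\mathcal G^2$, i.e.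 $q\in\mathsf{PWin}_1(\mathcal G^2)\setminus\mathsf{ASW}_1(\mathcal G^2)$, and let $(a,\gamma_1)\in\mathbf A_1$ with $(a,\gamma_1)\notin\mathsf{SR}_1(q,\mathcal G^2)$ and $\sigma_0\notin\gamma_1$. Then P2 has a strategy in $\mathcal H$ that prevents P1 from winning almost surely if P1 selects $(a,\gamma_1)$ at $q$, even if P1 has perfect observation and may query the hidden sensor later. Precisely, there is a strategy $\pi_2$ of P2 in $\mathcal H$ such that for every strategy $\pi_1$ of P1 in $\mathcal H$: if $\pi_1$ starts at $q$ by playing $(a,\gamma_1)$ with probability one, then $q_F$ is reached from $q$ with probability zero; and if $\pi_1$ starts at $q$ by playing $(a,\gamma_1)$ with positive probability, then $q_F$ is reached from $q$ with probability less than one. -/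

import Mathlib

open scoped ENNReal NNReal

noncomputable section

/-! ### Turn-based stochastic games with a reachability objective -/

/-- Who moves at a state, together with the resulting transition distributions. -/
inductive Turn (Q A₁ A₂ : Type*) where
  | one (δ : A₁ → PMF Q)
  | two (δ : A₂ → PMF Q)
  | chance (δ : PMF Q)

/-- A turn-based two-player stochastic game: `carrier` is its set of states inside the ambient
type `Q`, `enabledᵢ q` is the set of actions that player `i` may choose when it is his turn at `q`
(it plays no role at the states of the other players). -/
structure StochGame (Q A₁ A₂ : Type*) where
  carrier : Set Q
  turn : Q → Turn Q A₁ A₂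
  enabled₁ : Q → Set A₁
  enabled₂ : Q → Set A₂

/-- A play prefix: the current state, and the list (most recent first) of the earlier states, each
with the action that was taken there (`none` at a state of the chance player). -/
structure History (Q A₁ A₂ : Type*) where
  past : List (Q × Option (A₁ ⊕ A₂))
  cur : Q

namespace History

variable {Q A₁ A₂ : Type*}

/-- The prefix of length zero that consists of `q` alone. -/
def start (q : Q) : History Q A₁ A₂ := ⟨[], q⟩

/-- Extend a prefix by an action and the state that is reached. -/
def extend (h : History Q A₁ A₂) (x : Option (A₁ ⊕ A₂)) (q : Q) : History Q A₁ A₂ :=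
  ⟨(h.cur, x) :: h.past, q⟩

/-- Some state of the prefix lies in `T`. -/
def Visits (T : Set Q) (h : History Q A₁ A₂) : Prop :=
  h.cur ∈ T ∨ ∃ p ∈ h.past, p.1 ∈ T

end History

namespace StochGame

variable {Q A₁ A₂ : Type*}

/-- History-dependent randomized strategies of player 1, with perfect observation. -/
def Strategy₁ (G : StochGame Q A₁ A₂) :=
  {π : History Q A₁ A₂ → PMF A₁ // ∀ h, (π h).support ⊆ G.enabled₁ h.cur}

/-- History-dependent randomized strategies of player 2, with perfect observation. -/
def Strategy₂ (G : StochGame Q A₁ A₂) :=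
  {π : History Q A₁ A₂ → PMF A₂ // ∀ h, (π h).support ⊆ G.enabled₂ h.cur}

/-- One round of the stochastic process induced by a strategy profile. -/
def stepDist (G : StochGame Q A₁ A₂) (π₁ : G.Strategy₁) (π₂ : G.Strategy₂)
    (h : History Q A₁ A₂) : PMF (History Q A₁ A₂) :=
  match G.turn h.cur with
  | .one δ => (π₁.1 h).bind fun x => (δ x).map (h.extend (some (.inl x)))
  | .two δ => (π₂.1 h).bind fun y => (δ y).map (h.extend (some (.inr y)))
  | .chance δ => δ.map (h.extend none)

/-- The law of the play prefix after `n` transitions from the state `q`. -/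
def histDist (G : StochGame Q A₁ A₂) (π₁ : G.Strategy₁) (π₂ : G.Strategy₂) (q : Q) :
    ℕ → PMF (History Q A₁ A₂)
  | 0 => PMF.pure (History.start q)
  | n + 1 => (G.histDist π₁ π₂ q n).bind (G.stepDist π₁ π₂)

/-- The probability that the play from `q` visits `T`. The events "`T` is visited within `n`
transitions" increase to this event, so its probability is the supremum of theirs. -/
def reachProb (G : StochGame Q A₁ A₂) (T : Set Q) (π₁ : G.Strategy₁) (π₂ : G.Strategy₂)
    (q : Q) : ℝ≥0∞ :=
  ⨆ n : ℕ, (G.histDist π₁ π₂ q n).toOuterMeasure {h | h.Visits T}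

/-- The states that are reached with positive probability when player 1 plays `x` at `q`. -/
def post₁ (G : StochGame Q A₁ A₂) (q : Q) (x : A₁) : Set Q :=
  match G.turn q with
  | .one δ => (δ x).support
  | _ => ∅

end StochGame

/-! ### Games with active sensing and sensor attacks -/

/-- A two-player stochastic reachability game with active sensing and sensor attacks, with state
set `S`, control actions `A`, and set of sensors `Sens`. -/
structure SensorGame (S A Sens : Type*) where
  /-- The sensor query actions of player 1. -/
  Γ₁ : Set (Set Sens)
  /-- The sensor attack actions of player 2. -/
  Γ₂ : Set (Set Sens)
  P : S → A → PMF S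
  O : Set (Set S)
  Obs : S → Γ₁ → Γ₂ → Set S
  obs_mem : ∀ s γ₁ γ₂, Obs s γ₁ γ₂ ∈ O
  s₀ : S
  o₀ : Set S
  o₀_mem : o₀ ∈ O
  s₀_mem : s₀ ∈ o₀
  /-- The goal states. -/
  F : Set S

/-- The values of the counter `κ_d`: `-1` as long as the hidden sensor has not been queried, then
`0, 1, …, τ`; player 2 can attack the hidden sensor from `τ` on. -/
abbrev Counter (τ : ℕ) : Type := Set.Icc (-1 : ℤ) (τ : ℤ)

/-- The states of the belief-augmented games: the true state `s`, the belief `B` of player 1, the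
actions chosen in the current round, and the counter `κ`. -/
inductive BState (S A Γ : Type*) (τ : ℕ) where
  | p1 (s : S) (B : Set S) (κ : Counter τ)
  | nature (s : S) (B : Set S) (a : A) (γ₁ : Γ) (κ : Counter τ)
  | p2 (s : S) (B : Set S) (γ₁ : Γ) (κ : Counter τ)
  | final

namespace SensorGame

variable {S A Sens : Type*}

/-- The possible successors of the states in `B` under the control action `a`. -/
def post (G : SensorGame S A Sens) (B : Set S) (a : A) : Set S :=
  {s' | ∃ s ∈ B, s' ∈ (G.P s a).support}

/-- The perception-control actions of player 1. -/
abbrev Act₁ (G : SensorGame S A Sens) := A × G.Γ₁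

/-- The actions of player 1 known to player 2: the query does not involve the hidden sensor. -/
def known₁ (G : SensorGame S A Sens) (σ₀ : Sens) : Set G.Act₁ :=
  {x | σ₀ ∉ (x.2 : Set Sens)}

/-- The attacks known to player 2 while she ignores the hidden sensor. -/
def known₂ (G : SensorGame S A Sens) (σ₀ : Sens) : Set G.Γ₂ :=
  {γ₂ | σ₀ ∉ (γ₂ : Set Sens)}

/-- The initial value `-1` of the counter. -/
def hiddenκ (τ : ℕ) : Counter τ := ⟨-1, by constructor <;> omega⟩

open Classical in
/-- Update of the counter when player 1 plays `x`. -/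
def nextκ (G : SensorGame S A Sens) (σ₀ : Sens) {τ : ℕ} (κ : Counter τ) (x : G.Act₁) :
    Counter τ :=
  if h : (κ : ℤ) = τ then κ
  else if (κ : ℤ) = -1 ∧ x ∈ G.known₁ σ₀ then κ
  else ⟨κ + 1, by have h1 := κ.2.1; have h2 := κ.2.2; constructor <;> omega⟩

open Classical in
/-- The transition out of a state of nature. If both goal and non-goal states are possible
successors, the final state is reached with probability `ε`. -/
def natureDist (G : SensorGame S A Sens) {τ : ℕ} (ε : ℝ≥0) (hε : ε ≤ 1)
    (s : S) (B : Set S) (a : A) (γ₁ : G.Γ₁) (κ : Counter τ) : PMF (BState S A G.Γ₁ τ) :=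
  if G.post {s} a ⊆ G.F then PMF.pure .final
  else if G.post {s} a ∩ G.F = ∅ then (G.P s a).map fun s' => .p2 s' B γ₁ κ
  else (PMF.bernoulli ε hε).bind fun b =>
    if b then PMF.pure .final else (G.P s a).map fun s' => .p2 s' B γ₁ κ

/-- The sensor-revealing game, with hidden sensor `σ₀`, delay in reaction `τ`, and constant `ε`. -/
def revealingGame (G : SensorGame S A Sens) (σ₀ : Sens) (τ : ℕ) (ε : ℝ≥0) (hε : ε ≤ 1) :
    StochGame (BState S A G.Γ₁ τ) G.Act₁ G.Γ₂ where
  carrier := Set.univ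
  turn
    | .p1 s B κ => .one fun x => PMF.pure (.nature s (G.post B x.1) x.1 x.2 (G.nextκ σ₀ κ x))
    | .nature s B a γ₁ κ => .chance (G.natureDist ε hε s B a γ₁ κ)
    | .p2 s B γ₁ κ => .two fun γ₂ => PMF.pure (.p1 s (B ∩ G.Obs s γ₁ γ₂) κ)
    | .final => .chance (PMF.pure .final)
  enabled₁ _ := Set.univ
  enabled₂
    | .p2 _ _ _ κ => {γ₂ | (κ : ℤ) < τ → γ₂ ∈ G.known₂ σ₀}
    | _ => Set.univ

/-- The belief-augmented perceptual game of player 2: the restriction of the sensor-revealing game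
to the states with counter `-1` (and the final state) and to the actions known to player 2. -/
def perceptualGame (G : SensorGame S A Sens) (σ₀ : Sens) (τ : ℕ) (ε : ℝ≥0) (hε : ε ≤ 1) :
    StochGame (BState S A G.Γ₁ τ) G.Act₁ G.Γ₂ where
  carrier := {q | match q with
    | .p1 _ _ κ => (κ : ℤ) = -1
    | .nature _ _ a γ₁ κ => (κ : ℤ) = -1 ∧ (a, γ₁) ∈ G.known₁ σ₀
    | .p2 _ _ _ κ => (κ : ℤ) = -1
    | .final => True}
  turn := (G.revealingGame σ₀ τ ε hε).turn
  enabled₁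
    | .p1 _ _ _ => G.known₁ σ₀
    | _ => Set.univ
  enabled₂
    | .p2 _ _ _ _ => G.known₂ σ₀
    | _ => Set.univ

end SensorGame

/-! ### Winning regions and subjective rationalizability in a belief-augmented game -/

namespace StochGame

variable {S A Γ A₁ A₂ : Type*} {τ : ℕ}

/-- At his own states, player 1 decides on the basis of his belief and of the counter alone. -/
def BeliefBased (G : StochGame (BState S A Γ τ) A₁ A₂) (π₁ : G.Strategy₁) : Prop :=
  ∀ h h' : History (BState S A Γ τ) A₁ A₂, ∀ (s s' : S) (B : Set S) (κ : Counter τ),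
    h.cur = .p1 s B κ → h'.cur = .p1 s' B κ → π₁.1 h = π₁.1 h'

/-- The states from which player 1, who observes partially, has an almost-sure winning strategy. -/
def ASW₁ (G : StochGame (BState S A Γ τ) A₁ A₂) : Set (BState S A Γ τ) :=
  {q ∈ G.carrier | ∃ π₁ : G.Strategy₁, G.BeliefBased π₁ ∧
    ∀ π₂ : G.Strategy₂, G.reachProb {.final} π₁ π₂ q = 1}

/-- The states from which player 1, who observes partially, has a positive winning strategy. -/
def PWin₁ (G : StochGame (BState S A Γ τ) A₁ A₂) : Set (BState S A Γ τ) :=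
  {q ∈ G.carrier | ∃ π₁ : G.Strategy₁, G.BeliefBased π₁ ∧
    ∀ π₂ : G.Strategy₂, 0 < G.reachProb {.final} π₁ π₂ q}

/-- The states from which player 2 has an almost-sure winning strategy, against a player 1 who
observes partially. -/
def ASW₂ (G : StochGame (BState S A Γ τ) A₁ A₂) : Set (BState S A Γ τ) :=
  {q ∈ G.carrier | ∃ π₂ : G.Strategy₂, ∀ π₁ : G.Strategy₁, G.BeliefBased π₁ →
    G.reachProb {.final} π₁ π₂ q = 0}

open Classical in
/-- The subjectively rationalizable actions of player 1 at his state `q`. The second case concerns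
the states that are positive winning but not almost-sure winning. -/
def SR₁ (G : StochGame (BState S A Γ τ) A₁ A₂) (q : BState S A Γ τ) : Set A₁ :=
  if q ∈ G.ASW₁ then {x ∈ G.enabled₁ q | G.post₁ q x ⊆ G.ASW₁}
  else if q ∈ G.PWin₁ then {x ∈ G.enabled₁ q | ¬ G.post₁ q x ⊆ G.ASW₂}
  else ∅

end StochGame

end

/-! Queries and attacks change only the belief and the counter; the true state moves by control
actions alone. Hence whether a goal can be reached with positive probability is a matter of the
transition graph on `S`. Since `(a, γ₁)` is not rationalizable, its successor lies in `ASW₂`. Some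
strategy of player 2 then defeats, in particular, the belief-blind player 1 who mixes uniformly over
all known actions. That player follows every control path with positive probability, so no path from
the successor meets `F` (`safeBState_of_mem_ASW₂`). This safety survives in the revealing game,
whatever is queried or attacked later, so any strategy of player 2 will do. Both claims follow from
one inequality: reaching probability plus the initial weight of `(a, γ₁)` is at most one
(`reachProb_add_apply_le_one`). -/

namespace PMF

variable {α : Type*}

theorem toOuterMeasure_add_le_one (p : PMF α) {s t : Set α} (h : Disjoint s t) :
    p.toOuterMeasure s + p.toOuterMeasure t ≤ 1 := by
  rw [toOuterMeasure_apply, toOuterMeasure_apply, ← ENNReal.tsum_add, ← p.tsum_coe]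
  refine ENNReal.tsum_le_tsum fun x => ?_
  have hx := congrFun (Set.indicator_union_of_disjoint h p) x
  rw [← hx]
  exact Set.indicator_le_self _ _ x

theorem toOuterMeasure_le_bind {β : Type*} (p : PMF α) (f : α → PMF β) {s : Set α} {t : Set β}
    (h : ∀ x ∈ s, (f x).support ⊆ t) :
    p.toOuterMeasure s ≤ (p.bind f).toOuterMeasure t := by
  rw [toOuterMeasure_bind_apply, toOuterMeasure_apply]
  refine ENNReal.tsum_le_tsum fun x => ?_
  by_cases hx : x ∈ s
  · rw [Set.indicator_of_mem hx, ((f x).toOuterMeasure_apply_eq_one_iff t).2 (h x hx), mul_one]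
  · simp [hx]

end PMF

/-! ### Invariants and positive-probability reachability in stochastic games. -/

namespace StochGame

variable {Q A₁ A₂ : Type*}

/-- If every play prefix in the set `I` stays in `I` and avoids `T`, then the probability of
visiting `T` is bounded by one minus the mass of `I` after one transition. -/
theorem reachProb_add_le_one (G : StochGame Q A₁ A₂) {T : Set Q} {π₁ : G.Strategy₁}
    {π₂ : G.Strategy₂} {q : Q} {I : Set (History Q A₁ A₂)} (hq : q ∉ T)
    (hstep : ∀ h ∈ I, (G.stepDist π₁ π₂ h).support ⊆ I) (hI : ∀ h ∈ I, ¬ h.Visits T) :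
    G.reachProb T π₁ π₂ q + (G.histDist π₁ π₂ q 1).toOuterMeasure I ≤ 1 := by
  have hmass : ∀ n, (G.histDist π₁ π₂ q 1).toOuterMeasure I ≤
      (G.histDist π₁ π₂ q (n + 1)).toOuterMeasure I := by
    intro n
    induction n with
    | zero => exact le_rfl
    | succ n ih => exact ih.trans (PMF.toOuterMeasure_le_bind _ _ hstep)
  rw [reachProb, ENNReal.iSup_add]
  refine iSup_le fun n => ?_
  cases n with
  | zero =>
    -- The mass of `I` is only controlled from time one on, so time zero needs `q ∉ T`.
    have h0 : (G.histDist π₁ π₂ q 0).toOuterMeasure {h | h.Visits T} = 0 := by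
      rw [PMF.toOuterMeasure_apply_eq_zero_iff, histDist, PMF.support_pure]
      simpa [History.Visits, History.start] using hq
    rw [h0, zero_add]
    simpa using PMF.toOuterMeasure_add_le_one (G.histDist π₁ π₂ q 1)
      (disjoint_bot_left : Disjoint (∅ : Set (History Q A₁ A₂)) I)
  | succ n =>
    refine (add_le_add_right (hmass n) _).trans (PMF.toOuterMeasure_add_le_one _ ?_)
    exact Set.disjoint_left.2 fun h hT h' => hI h h' hT

theorem not_visits_of_reachProb_eq_zero (G : StochGame Q A₁ A₂) {T : Set Q} {π₁ : G.Strategy₁}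
    {π₂ : G.Strategy₂} {q : Q} (h0 : G.reachProb T π₁ π₂ q = 0) {n : ℕ}
    {h : History Q A₁ A₂} (hh : h ∈ (G.histDist π₁ π₂ q n).support) : ¬ h.Visits T := by
  intro hT
  have hn : (G.histDist π₁ π₂ q n).toOuterMeasure {h | h.Visits T} = 0 := by
    rw [reachProb, ENNReal.iSup_eq_zero] at h0
    exact h0 n
  rw [PMF.toOuterMeasure_apply_eq_zero_iff] at hn
  exact Set.disjoint_left.1 hn hh hT

/-- The states in which some play from `q` is with positive probability after some time. -/
def ReachableUnder (G : StochGame Q A₁ A₂) (π₁ : G.Strategy₁) (π₂ : G.Strategy₂) (q q' : Q) :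
    Prop :=
  ∃ n, ∃ h ∈ (G.histDist π₁ π₂ q n).support, h.cur = q'

variable {G : StochGame Q A₁ A₂} {π₁ : G.Strategy₁} {π₂ : G.Strategy₂} {q q' q'' : Q}

theorem ReachableUnder.refl : G.ReachableUnder π₁ π₂ q q :=
  ⟨0, History.start q, by simp [histDist], rfl⟩

theorem ReachableUnder.chance (hr : G.ReachableUnder π₁ π₂ q q') {δ : PMF Q}
    (ht : G.turn q' = .chance δ) (h' : q'' ∈ δ.support) : G.ReachableUnder π₁ π₂ q q'' := by
  obtain ⟨n, h, hh, rfl⟩ := hr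
  refine ⟨n + 1, h.extend none q'', ?_, rfl⟩
  rw [histDist, PMF.mem_support_bind_iff]
  refine ⟨h, hh, ?_⟩
  rw [stepDist, ht, PMF.mem_support_map_iff]
  exact ⟨q'', h', rfl⟩

theorem ReachableUnder.one (hr : G.ReachableUnder π₁ π₂ q q') {δ : A₁ → PMF Q}
    (ht : G.turn q' = .one δ) {x : A₁} (hx : ∀ h, h.cur = q' → x ∈ (π₁.1 h).support)
    (h' : q'' ∈ (δ x).support) : G.ReachableUnder π₁ π₂ q q'' := by
  obtain ⟨n, h, hh, rfl⟩ := hr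
  refine ⟨n + 1, h.extend (some (.inl x)) q'', ?_, rfl⟩
  rw [histDist, PMF.mem_support_bind_iff]
  refine ⟨h, hh, ?_⟩
  rw [stepDist, ht, PMF.mem_support_bind_iff]
  refine ⟨x, hx h rfl, ?_⟩
  rw [PMF.mem_support_map_iff]
  exact ⟨q'', h', rfl⟩

theorem ReachableUnder.two (hr : G.ReachableUnder π₁ π₂ q q') {δ : A₂ → PMF Q}
    (ht : G.turn q' = .two δ) : ∃ y, ∀ q'' ∈ (δ y).support, G.ReachableUnder π₁ π₂ q q'' := by
  obtain ⟨n, h, hh, rfl⟩ := hr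
  obtain ⟨y, hy⟩ := (π₂.1 h).support_nonempty
  refine ⟨y, fun q'' h' => ⟨n + 1, h.extend (some (.inr y)) q'', ?_, rfl⟩⟩
  rw [histDist, PMF.mem_support_bind_iff]
  refine ⟨h, hh, ?_⟩
  rw [stepDist, ht, PMF.mem_support_bind_iff]
  refine ⟨y, hy, ?_⟩
  rw [PMF.mem_support_map_iff]
  exact ⟨q'', h', rfl⟩

end StochGame

/-! ### Safety as a property of the control graph. -/

namespace SensorGame

variable {S A Sens : Type*}

/-- No sequence of control actions leads from `s` to a goal state. -/
def SafeState (G : SensorGame S A Sens) (s : S) : Prop :=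
  ∀ s', Relation.ReflTransGen (fun x y => ∃ a, y ∈ G.post {x} a) s s' →
    ∀ a, G.post {s'} a ∩ G.F = ∅

/-- A state of the sensor-revealing game from which the final state cannot be reached. -/
def SafeBState (G : SensorGame S A Sens) {τ : ℕ} : BState S A G.Γ₁ τ → Prop
  | .p1 s _ _ => G.SafeState s
  | .nature s _ a _ _ => G.post {s} a ∩ G.F = ∅ ∧ ∀ s' ∈ G.post {s} a, G.SafeState s'
  | .p2 s _ _ _ => G.SafeState s
  | .final => False

theorem post_singleton (G : SensorGame S A Sens) (s : S) (a : A) :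
    G.post {s} a = (G.P s a).support := by
  ext; simp [post]

theorem post_singleton_nonempty (G : SensorGame S A Sens) (s : S) (a : A) :
    (G.post {s} a).Nonempty :=
  G.post_singleton s a ▸ (G.P s a).support_nonempty

theorem SafeState.post {G : SensorGame S A Sens} {s : S} (h : G.SafeState s) (a : A) :
    G.post {s} a ∩ G.F = ∅ ∧ ∀ s' ∈ G.post {s} a, G.SafeState s' :=
  ⟨h s .refl a, fun _ hs' t ht => h t (ht.head ⟨a, hs'⟩)⟩

variable (G : SensorGame S A Sens) {σ₀ : Sens} {τ : ℕ} {ε : ℝ≥0} {hε : ε ≤ 1}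

theorem natureDist_of_inter_eq_empty {s : S} {a : A} (h : G.post {s} a ∩ G.F = ∅) (B : Set S)
    (γ₁ : G.Γ₁) (κ : Counter τ) :
    G.natureDist ε hε s B a γ₁ κ = (G.P s a).map fun s' => .p2 s' B γ₁ κ := by
  rw [natureDist, if_neg, if_pos h]
  intro hF
  rw [Set.inter_eq_left.2 hF] at h
  exact (G.post_singleton_nonempty s a).ne_empty h

/-- The positivity of `ε` makes every possible goal successor visible as a positive chance of
`final`. -/
theorem final_mem_support_natureDist (hε₀ : 0 < ε) {s : S} {a : A}
    (h : G.post {s} a ∩ G.F ≠ ∅) (B : Set S) (γ₁ : G.Γ₁) (κ : Counter τ) :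
    BState.final ∈ (G.natureDist ε hε s B a γ₁ κ).support := by
  rw [natureDist]
  split_ifs with hF
  · simp
  · rw [PMF.mem_support_bind_iff]
    refine ⟨true, ?_, by simp⟩
    rw [PMF.mem_support_iff, PMF.bernoulli_apply]
    simpa using hε₀.ne'

theorem nextκ_hiddenκ {x : G.Act₁} (hx : x ∈ G.known₁ σ₀) :
    G.nextκ σ₀ (hiddenκ τ) x = hiddenκ τ := by
  have h : ((hiddenκ τ : Counter τ) : ℤ) = -1 := rfl
  rw [nextκ, dif_neg (by rw [h]; omega), if_pos ⟨h, hx⟩]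

/-- Safety does not mention belief or counter, so no move of either player can destroy it. The
clause on `past` lets the absence of earlier visits to `final` be inherited. -/
theorem SafeBState.stepDist (π₁ : (G.revealingGame σ₀ τ ε hε).Strategy₁)
    (π₂ : (G.revealingGame σ₀ τ ε hε).Strategy₂) {h h' : History (BState S A G.Γ₁ τ) G.Act₁ G.Γ₂}
    (hs : G.SafeBState h.cur) (hh' : h' ∈ ((G.revealingGame σ₀ τ ε hε).stepDist π₁ π₂ h).support) :
    G.SafeBState h'.cur ∧ ∃ x, h'.past = (h.cur, x) :: h.past := by
  obtain ⟨past, cur⟩ := h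
  cases cur with
  | p1 s B κ =>
    simp only [StochGame.stepDist, revealingGame, PMF.mem_support_bind_iff,
      PMF.mem_support_map_iff, PMF.mem_support_pure_iff] at hh'
    obtain ⟨x, -, _, rfl, rfl⟩ := hh'
    exact ⟨SafeState.post hs x.1, _, rfl⟩
  | nature s B a γ κ =>
    obtain ⟨hs₁, hs₂⟩ := hs
    simp only [StochGame.stepDist, revealingGame, PMF.mem_support_map_iff,
      G.natureDist_of_inter_eq_empty hs₁] at hh'
    obtain ⟨_, ⟨s', hs', rfl⟩, rfl⟩ := hh'
    exact ⟨hs₂ s' (by rwa [post_singleton]), _, rfl⟩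
  | p2 s B γ κ =>
    simp only [StochGame.stepDist, revealingGame, PMF.mem_support_bind_iff,
      PMF.mem_support_map_iff, PMF.mem_support_pure_iff] at hh'
    obtain ⟨y, -, _, rfl, rfl⟩ := hh'
    exact ⟨hs, _, rfl⟩
  | final => exact hs.elim

/-- Whatever player 2 does, the final state is reached with probability at most one minus the
probability of an initial action of player 1 that leads to a safe state. -/
theorem reachProb_add_apply_le_one (π₁ : (G.revealingGame σ₀ τ ε hε).Strategy₁)
    (π₂ : (G.revealingGame σ₀ τ ε hε).Strategy₂) (s : S) (B : Set S) (κ : Counter τ)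
    (x : G.Act₁) (hx : G.SafeBState
      (.nature s (G.post B x.1) x.1 x.2 (G.nextκ σ₀ κ x) : BState S A G.Γ₁ τ)) :
    (G.revealingGame σ₀ τ ε hε).reachProb {BState.final} π₁ π₂ (.p1 s B κ) +
      π₁.1 (History.start (.p1 s B κ)) x ≤ 1 := by
  set q : BState S A G.Γ₁ τ := .p1 s B κ with hq
  let I : Set (History (BState S A G.Γ₁ τ) G.Act₁ G.Γ₂) :=
    {h | G.SafeBState h.cur ∧ ¬ h.Visits {BState.final}}
  have hvis : ∀ h : History (BState S A G.Γ₁ τ) G.Act₁ G.Γ₂,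
      G.SafeBState h.cur → h.cur ≠ .final := by
    intro h hs hf
    rw [hf] at hs
    exact hs
  refine (add_le_add_right ?_ _).trans ((G.revealingGame σ₀ τ ε hε).reachProb_add_le_one
    (I := I) (T := {BState.final}) (by simp [hq]) ?_ fun h hh => hh.2)
  -- The move after `x` is deterministic, so the mass of `I` at time one is at least the weight of
  -- `x`.
  · have h1 : (G.revealingGame σ₀ τ ε hε).histDist π₁ π₂ q 1 =
        (π₁.1 (History.start q)).bind fun x => PMF.pure ((History.start q).extend
          (some (.inl x)) (.nature s (G.post B x.1) x.1 x.2 (G.nextκ σ₀ κ x))) := by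
      simp only [StochGame.histDist, PMF.pure_bind, StochGame.stepDist, revealingGame,
        History.start, hq, PMF.pure_map]
    rw [h1, ← PMF.toOuterMeasure_apply_singleton]
    refine PMF.toOuterMeasure_le_bind _ _ ?_
    rintro _ rfl
    rw [PMF.support_pure, Set.singleton_subset_iff]
    refine ⟨hx, ?_⟩
    simp [History.Visits, History.extend, History.start, hq]
  · rintro h ⟨hs, hv⟩ h' hh'
    obtain ⟨hs', y, hy⟩ := SafeBState.stepDist G π₁ π₂ hs hh'
    refine ⟨hs', ?_⟩
    rintro (hf | ⟨p, hp, hf⟩)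
    · exact hvis h' hs' hf
    · rw [hy, List.mem_cons] at hp
      rcases hp with rfl | hp
      · exact hv (.inl hf)
      · exact hv (.inr ⟨p, hp, hf⟩)

/-- Player 1 chooses uniformly among his actions that are known to player 2. -/
theorem exists_fullSupport_strategy [Finite A] [Finite Sens] (hne : (G.known₁ σ₀).Nonempty) :
    ∃ π₁ : (G.perceptualGame σ₀ τ ε hε).Strategy₁,
      (G.perceptualGame σ₀ τ ε hε).BeliefBased π₁ ∧
        ∀ h, (π₁.1 h).support = G.known₁ σ₀ := by
  have hfin : (G.known₁ σ₀).Finite := Set.toFinite _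
  let μ : PMF G.Act₁ := PMF.uniformOfFinset hfin.toFinset (by simpa using hne)
  have hμ : μ.support = G.known₁ σ₀ := by simp [μ]
  refine ⟨⟨fun _ => μ, fun h => ?_⟩, fun _ _ _ _ _ _ _ _ => rfl, fun _ => hμ⟩
  rw [hμ]
  simp only [perceptualGame]
  split
  · exact subset_rfl
  · exact Set.subset_univ _

/-- A control path to a goal would be followed with positive probability by the full-support
strategy, repeating the query `γ₁` throughout. -/
theorem safeBState_of_mem_ASW₂ [Finite A] [Finite Sens] (hε₀ : 0 < ε) {s : S} {B : Set S} {a : A}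
    {γ₁ : G.Γ₁} (hγ : σ₀ ∉ (γ₁ : Set Sens))
    (hq : BState.nature s B a γ₁ (hiddenκ τ) ∈ (G.perceptualGame σ₀ τ ε hε).ASW₂) :
    G.SafeBState (BState.nature s B a γ₁ (hiddenκ τ)) := by
  obtain ⟨-, π₂, hπ₂⟩ := hq
  obtain ⟨π₁, hb, hsupp⟩ := G.exists_fullSupport_strategy (τ := τ) (ε := ε) (hε := hε)
    (σ₀ := σ₀) ⟨(a, γ₁), hγ⟩
  have h0 := hπ₂ π₁ hb
  set q : BState S A G.Γ₁ τ := .nature s B a γ₁ (hiddenκ τ)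
  let R := (G.perceptualGame σ₀ τ ε hε).ReachableUnder π₁ π₂ q
  have hfinal : ¬ R .final := by
    rintro ⟨n, h, hh, hf⟩
    exact StochGame.not_visits_of_reachProb_eq_zero _ h0 hh (.inl hf)
  have hnature : ∀ t C b, R (.nature t C b γ₁ (hiddenκ τ)) →
      G.post {t} b ∩ G.F = ∅ ∧
        ∀ t' ∈ G.post {t} b, ∃ C', R (.p1 t' C' (hiddenκ τ)) := by
    intro t C b hR
    have hemp : G.post {t} b ∩ G.F = ∅ := by
      by_contra hne
      exact hfinal (hR.chance rfl (G.final_mem_support_natureDist hε₀ hne C γ₁ _))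
    refine ⟨hemp, fun t' ht' => ?_⟩
    have h2 : R (.p2 t' C γ₁ (hiddenκ τ)) := by
      refine hR.chance rfl ?_
      rw [G.natureDist_of_inter_eq_empty hemp, PMF.mem_support_map_iff]
      exact ⟨t', by rwa [← post_singleton], rfl⟩
    -- Any reply of player 2 keeps the true state `t'`; only the belief depends on it, hence the
    -- existential over `C'`.
    obtain ⟨y, hy⟩ := h2.two rfl
    exact ⟨_, hy _ ((PMF.mem_support_pure_iff _ _).2 rfl)⟩
  have hp1 : ∀ t C b, R (.p1 t C (hiddenκ τ)) →
      R (.nature t (G.post C b) b γ₁ (hiddenκ τ)) := by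
    intro t C b hR
    have hk : (b, γ₁) ∈ G.known₁ σ₀ := hγ
    refine hR.one rfl (x := (b, γ₁)) (fun h _ => by rw [hsupp]; exact hk) ?_
    rw [PMF.mem_support_pure_iff, G.nextκ_hiddenκ hk]
  obtain ⟨he, hn⟩ := hnature s B a .refl
  refine ⟨he, fun s' hs' t ht b => ?_⟩
  have hreach : ∃ C, R (.p1 t C (hiddenκ τ)) := by
    induction ht with
    | refl => exact hn s' hs'
    | tail _ hstep ih =>
      obtain ⟨C, hC⟩ := ih
      obtain ⟨c, hc⟩ := hstep
      exact (hnature _ _ c (hp1 _ _ c hC)).2 _ hc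
  obtain ⟨C, hC⟩ := hreach
  exact (hnature _ _ b (hp1 _ _ b hC)).1

/-- Sampling `π₂` at a player 2 state yields an attack avoiding `σ₀`. Such an attack is legal for
every counter value, so it can be played constantly. -/
theorem nonempty_strategy₂_revealingGame (π₂ : (G.perceptualGame σ₀ τ ε hε).Strategy₂) (s : S)
    (B : Set S) (γ₁ : G.Γ₁) : Nonempty (G.revealingGame σ₀ τ ε hε).Strategy₂ := by
  let h₀ : History (BState S A G.Γ₁ τ) G.Act₁ G.Γ₂ := History.start (.p2 s B γ₁ (hiddenκ τ))
  obtain ⟨y, hy⟩ := (π₂.1 h₀).support_nonempty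
  have hy' : y ∈ G.known₂ σ₀ := π₂.2 h₀ hy
  refine ⟨⟨fun _ => PMF.pure y, fun h => ?_⟩⟩
  rw [PMF.support_pure, Set.singleton_subset_iff]
  simp only [revealingGame]
  split
  · exact fun _ => hy'
  · exact Set.mem_univ _

end SensorGame

theorem mainTheorem2 {S A Sens : Type*} [Finite S] [Finite A] [Finite Sens]
    (G : SensorGame S A Sens) (σ₀ : Sens) (τ : ℕ) (ε : ℝ≥0) (hε₀ : 0 < ε) (hε₁ : ε < 1)
    (s : S) (B : Set S) (a : A) (γ₁ : G.Γ₁)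
    (hpos : BState.p1 s B (SensorGame.hiddenκ τ) ∈ (G.perceptualGame σ₀ τ ε hε₁.le).PWin₁)
    (hnot : BState.p1 s B (SensorGame.hiddenκ τ) ∉ (G.perceptualGame σ₀ τ ε hε₁.le).ASW₁)
    (hSR : (a, γ₁) ∉
      (G.perceptualGame σ₀ τ ε hε₁.le).SR₁ (BState.p1 s B (SensorGame.hiddenκ τ)))
    (hγ : σ₀ ∉ (γ₁ : Set Sens)) :
    ∃ π₂ : (G.revealingGame σ₀ τ ε hε₁.le).Strategy₂,
      ∀ π₁ : (G.revealingGame σ₀ τ ε hε₁.le).Strategy₁,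
        (π₁.1 (History.start (BState.p1 s B (SensorGame.hiddenκ τ))) = PMF.pure (a, γ₁) →
          (G.revealingGame σ₀ τ ε hε₁.le).reachProb {BState.final} π₁ π₂
            (BState.p1 s B (SensorGame.hiddenκ τ)) = 0) ∧
        (0 < π₁.1 (History.start (BState.p1 s B (SensorGame.hiddenκ τ))) (a, γ₁) →
          (G.revealingGame σ₀ τ ε hε₁.le).reachProb {BState.final} π₁ π₂
            (BState.p1 s B (SensorGame.hiddenκ τ)) < 1) := by
  have hk : (a, γ₁) ∈ G.known₁ σ₀ := hγ
  have hASW : BState.nature s (G.post B a) a γ₁ (SensorGame.hiddenκ τ) ∈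
      (G.perceptualGame σ₀ τ ε hε₁.le).ASW₂ := by
    rw [StochGame.SR₁, if_neg hnot, if_pos hpos] at hSR
    have hsub := not_not.1 fun hn => hSR ⟨hk, hn⟩
    refine hsub ((PMF.mem_support_pure_iff _ _).2 ?_)
    rw [G.nextκ_hiddenκ hk]
  have hsafe := G.safeBState_of_mem_ASW₂ hε₀ hγ hASW
  -- Only the existence of `ρ` matters here: it supplies a legal attack.
  obtain ⟨-, ρ, -⟩ := hASW
  obtain ⟨π₂⟩ := G.nonempty_strategy₂_revealingGame ρ s B γ₁
  refine ⟨π₂, fun π₁ => ?_⟩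
  have hle := G.reachProb_add_apply_le_one π₁ π₂ s B (SensorGame.hiddenκ τ) (a, γ₁)
    (by rw [G.nextκ_hiddenκ hk]; exact hsafe)
  constructor
  · intro hpure
    rw [hpure, PMF.pure_apply_self] at hle
    exact nonpos_iff_eq_zero.1 (ENNReal.le_of_add_le_add_right ENNReal.one_ne_top
      (by rwa [zero_add]))
  · intro hp
    refine lt_of_lt_of_le (ENNReal.lt_add_right ?_ hp.ne') hle
    -- In `ℝ≥0∞`, adding a positive weight is strict only at a finite value.
    exact ne_top_of_le_ne_top ENNReal.one_ne_top (le_self_add.trans hle)
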